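/- Let $n\ge 2$ be an integer, let $H_0^1(0,1)$ be the closure of $C_c^\infty(0,1)$ in the (real) Sobolev space $H^1(0,1)$, and let $H^{-1}(0,1)$ be its topological dual. Each $u\in H_0^1(0,1)$ is identified with its continuous representative, and $H_0^1(0,1)\subset L^2(0,1)\subset H^{-1}(0,1)$ via $\langle u,\varphi\rangle=\int_0^1 u\varphi\,dx$. Let $L=-\partial_{xx}-4n\sum_{k=1}^{n-1}\delta_{k/n}$ be the operator in $H^{-1}(0,1)$ with domain $H_0^1(0,1)$ given by $$\langle Lu,\varphi\rangle=\int_0^1 u'\varphi'\,dx-4n\sum_{k=1}^{n-1}u\left(\tfrac kn\right)\varphi\left(\tfrac kn\right),\qquad u,\varphi\in H_0^1(0,1).$$ A real number $\lambda$ is an eigenvalue of $L$ if there is $u\in H_0^1(0,1)$, $u\neq 0$, with $Lu=\lambda u$ in $H^{-1}(0,1)$. Then: 1. $L$ has at least one negative eigenvalue; 2. the number of negative eigenvalues of $L$, counted with multiplicity, is finite, that is, $L$ has only finitely many distinct negative eigenvalues and each of them has a finite-dimensional eigenspace; 3. $0$ is not an eigenvalue of $L$. -/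

import Mathlib

open MeasureTheory Set Filter Topology
open scoped Distributions ENNReal ContDiff

noncomputable section

namespace DiracLinearization

/-- Lebesgue measure on the interval `(0,1)`. -/
abbrev mu : Measure ℝ := volume.restrict (Ioo (0 : ℝ) 1)

/-- The real Hilbert space `L²(0,1)`. -/
abbrev L2 : Type := Lp ℝ 2 mu

/-- The open interval `(0,1)` as a bundled open set. -/
abbrev unitInt : TopologicalSpace.Opens ℝ := ⟨Ioo (0 : ℝ) 1, isOpen_Ioo⟩

/-- The test functions `C_c^∞(0,1)`. -/
abbrev Test : Type := 𝓓(unitInt, ℝ)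

lemma Test.contDiff_infty (φ : Test) : ContDiff ℝ ∞ (φ : ℝ → ℝ) := φ.contDiff

lemma Test.memLp (φ : Test) : MemLp (φ : ℝ → ℝ) 2 mu :=
  φ.continuous.memLp_of_hasCompactSupport φ.hasCompactSupport

lemma Test.continuous_deriv (φ : Test) : Continuous (deriv (φ : ℝ → ℝ)) :=
  φ.contDiff_infty.continuous_deriv (by simp)

lemma Test.differentiable (φ : Test) : Differentiable ℝ (φ : ℝ → ℝ) :=
  φ.contDiff_infty.differentiable (by simp)

lemma Test.memLp_deriv (φ : Test) : MemLp (deriv (φ : ℝ → ℝ)) 2 mu :=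
  φ.continuous_deriv.memLp_of_hasCompactSupport φ.hasCompactSupport.deriv

/-- The Hilbert space `L²(0,1) × L²(0,1)`, with inner product
`⟪(u, v), (w, z)⟫ = ∫ u w + ∫ v z`, in which a Sobolev function `u` is represented by
the pair `(u, u')`. -/
abbrev L2Pair : Type := WithLp 2 (L2 × L2)

/-- The map `φ ↦ (φ, φ')` from test functions to `L²(0,1) × L²(0,1)`. -/
def testPair : Test →ₗ[ℝ] L2Pair where
  toFun φ := WithLp.toLp 2 (φ.memLp.toLp _, φ.memLp_deriv.toLp _)
  map_add' φ ψ := by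
    have h : deriv ((φ + ψ : Test) : ℝ → ℝ) = deriv (φ : ℝ → ℝ) + deriv (ψ : ℝ → ℝ) := by
      funext x
      exact deriv_add (φ.differentiable x) (ψ.differentiable x)
    rw [← WithLp.toLp_add]
    congr 1
    refine Prod.ext ?_ ?_
    · exact MemLp.toLp_add φ.memLp ψ.memLp
    · simp only [h]
      exact MemLp.toLp_add φ.memLp_deriv ψ.memLp_deriv
  map_smul' c φ := by
    have h : deriv ((c • φ : Test) : ℝ → ℝ) = c • deriv (φ : ℝ → ℝ) := by
      funext x
      exact deriv_const_smul c (φ.differentiable x)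
    rw [RingHom.id_apply, ← WithLp.toLp_smul]
    congr 1
    refine Prod.ext ?_ ?_
    · exact MemLp.toLp_const_smul c φ.memLp
    · simp only [h]
      exact MemLp.toLp_const_smul c φ.memLp_deriv

/-- `v` is the weak derivative of `u` on `(0,1)`. -/
def IsWeakDeriv (u v : L2) : Prop :=
  ∀ φ : Test, ∫ x, u x * deriv (φ : ℝ → ℝ) x ∂mu = -∫ x, v x * φ x ∂mu

/-- The Sobolev space `H_0^1(0,1)`: the closure of `C_c^∞(0,1)` in the norm
`(‖u‖² + ‖u'‖²)^{1/2}`.  An element is the pair `(u, u')` of a function and its weak derivative. -/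
def H01 : Submodule ℝ L2Pair := (LinearMap.range testPair).topologicalClosure

/-- The function in `L²(0,1)` underlying an element of `H_0^1(0,1)`. -/
def fn : H01 →L[ℝ] L2 := WithLp.fstL 2 ℝ L2 L2 ∘L H01.subtypeL

/-- The (weak) derivative of an element of `H_0^1(0,1)`; see `isWeakDeriv`. -/
def dx : H01 →L[ℝ] L2 := WithLp.sndL 2 ℝ L2 L2 ∘L H01.subtypeL

/-- The embedding of test functions into `H_0^1(0,1)`. -/
def ofTest (φ : Test) : H01 :=
  ⟨testPair φ, Submodule.le_topologicalClosure _ ⟨φ, rfl⟩⟩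

lemma fn_ofTest (φ : Test) : fn (ofTest φ) =ᵐ[mu] φ := φ.memLp.coeFn_toLp

lemma dx_ofTest (φ : Test) : dx (ofTest φ) =ᵐ[mu] deriv (φ : ℝ → ℝ) := φ.memLp_deriv.coeFn_toLp

lemma dense_ofTest : DenseRange ofTest := by
  intro u
  rw [closure_subtype]
  have h : (u : L2Pair) ∈ closure ((LinearMap.range testPair : Submodule ℝ L2Pair) : Set L2Pair) :=
    u.2
  refine closure_mono ?_ h
  rintro _ ⟨φ, rfl⟩
  exact ⟨ofTest φ, ⟨φ, rfl⟩, rfl⟩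

lemma setIntegral_dx_eq_inner (u : H01) (x : ℝ) :
    ∫ t in Iic x, dx u t ∂mu =
      inner ℝ (indicatorConstLp 2 (measurableSet_Iic (a := x)) (measure_ne_top mu _) (1 : ℝ))
        (dx u) :=
  (L2.inner_indicatorConstLp_one _ _ _).symm

/-- Point evaluation `u ↦ u(x)` on `H_0^1(0,1)`, i.e. the value at `x` of the continuous
representative `u(x) = ∫_0^x u'(t) dt` of `u`; see `eval_ofTest`, `continuous_eval`
and `fn_ae_eq_eval`. -/
def eval (u : H01) (x : ℝ) : ℝ := ∫ t in Iic x, dx u t ∂mu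

/-- The space `H^{-1}(0,1)`, the topological dual of `H_0^1(0,1)`. -/
abbrev Hm1 : Type := StrongDual ℝ H01

/-- The Dirac distribution `δ_x ∈ H^{-1}(0,1)`, `⟨δ_x, φ⟩ = φ(x)`. -/
def dirac (x : ℝ) : Hm1 :=
  innerSL ℝ (indicatorConstLp 2 (measurableSet_Iic (a := x)) (measure_ne_top mu _) (1 : ℝ)) ∘L dx

lemma dirac_apply (x : ℝ) (u : H01) : dirac x u = eval u x := (setIntegral_dx_eq_inner u x).symm

lemma Test.eq_zero (φ : Test) {x : ℝ} (hx : x ∉ Ioo (0 : ℝ) 1) : φ x = 0 :=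
  image_eq_zero_of_notMem_tsupport fun h => hx (φ.tsupport_subset h)

lemma Test.deriv_eq_zero (φ : Test) {x : ℝ} (hx : x ∉ Ioo (0 : ℝ) 1) :
    deriv (φ : ℝ → ℝ) x = 0 :=
  image_eq_zero_of_notMem_tsupport fun h =>
    hx (φ.tsupport_subset (closure_minimal (support_deriv_subset (f := φ)) isClosed_closure h))

/-- On test functions `eval` is the usual evaluation. -/
lemma eval_ofTest (φ : Test) (x : ℝ) : eval (ofTest φ) x = φ x := by
  have h1 : ∫ t in Iic x, dx (ofTest φ) t ∂mu = ∫ t in Iic x, deriv (φ : ℝ → ℝ) t ∂mu :=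
    integral_congr_ae (ae_restrict_of_ae (dx_ofTest φ))
  rw [eval, h1, Measure.restrict_restrict measurableSet_Iic]
  rw [← HasCompactSupport.integral_Iic_deriv_eq (φ.contDiff_infty.of_le (by simp))
    φ.hasCompactSupport x]
  refine (setIntegral_eq_of_subset_of_forall_sdiff_eq_zero measurableSet_Iic
    inter_subset_left ?_).symm
  intro t ht
  exact φ.deriv_eq_zero fun h => ht.2 ⟨ht.1, h⟩

/-- `x ↦ u(x)` is continuous. -/
lemma continuous_eval (u : H01) : Continuous (eval u) := by
  have hint : Integrable (dx u) mu := (Lp.memLp (dx u)).integrable (by norm_num)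
  have h := hint.continuous_primitive 0
  have h2 : eval u = fun x => (∫ t in (0 : ℝ)..x, dx u t ∂mu) + ∫ t in Iic 0, dx u t ∂mu := by
    funext x
    rw [← intervalIntegral.integral_Iic_sub_Iic hint.integrableOn hint.integrableOn]
    simp [eval]
  rw [h2]
  exact h.add continuous_const

/-- `x ↦ u(x)` is a representative of `u`. -/
lemma fn_ae_eq_eval (u : H01) : fn u =ᵐ[mu] eval u := by
  obtain ⟨s, hs, hlim⟩ := mem_closure_iff_seq_limit.1 (dense_ofTest u)
  choose φ hφ using hs
  have hm : TendstoInMeasure mu (fun n => fn (s n)) atTop (fn u) :=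
    tendstoInMeasure_of_tendsto_Lp ((fn.continuous.tendsto u).comp hlim)
  obtain ⟨ns, hns, hae⟩ := hm.exists_seq_tendsto_ae
  have hall : ∀ᵐ x ∂mu, ∀ n, fn (s n) x = eval (s n) x := by
    refine ae_all_iff.2 fun n => ?_
    rw [← hφ n]
    filter_upwards [fn_ofTest (φ n)] with x hx
    rw [hx, eval_ofTest]
  filter_upwards [hae, hall] with x hx hn
  have h2 : Tendsto (fun n => eval (s (ns n)) x) atTop (𝓝 (eval u x)) := by
    simp only [← dirac_apply]
    exact (((dirac x).continuous.tendsto u).comp hlim).comp hns.tendsto_atTop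
  refine tendsto_nhds_unique hx ?_
  simpa only [hn] using h2

/-- Elements of `H_0^1(0,1)` satisfy the Dirichlet conditions. -/
lemma eval_boundary (u : H01) : eval u 0 = 0 ∧ eval u 1 = 0 := by
  have key : ∀ x ∉ Ioo (0 : ℝ) 1, dirac x u = 0 := by
    intro x hx
    have hc : IsClosed {u : H01 | dirac x u = 0} :=
      isClosed_eq (dirac x).continuous continuous_const
    refine dense_ofTest.induction_on u hc fun φ => ?_
    change dirac x (ofTest φ) = 0
    rw [dirac_apply, eval_ofTest, φ.eq_zero hx]
  exact ⟨by rw [← dirac_apply]; exact key 0 (by simp), by rw [← dirac_apply]; exact key 1 (by simp)⟩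

lemma integral_mul_eq_inner (f : L2) {g : ℝ → ℝ} (hg : MemLp g 2 mu) :
    ∫ x, f x * g x ∂mu = inner ℝ (hg.toLp g) f := by
  rw [L2.inner_def]
  refine integral_congr_ae ?_
  filter_upwards [hg.coeFn_toLp] with x hx
  rw [hx]
  simp

/-- The second component of an element of `H_0^1(0,1)` is the weak derivative of the first. -/
lemma isWeakDeriv (u : H01) : IsWeakDeriv (fn u) (dx u) := by
  intro φ
  rw [integral_mul_eq_inner _ φ.memLp_deriv, integral_mul_eq_inner _ φ.memLp]
  have hc : IsClosed {u : H01 | inner ℝ (φ.memLp_deriv.toLp _) (fn u) =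
      -inner ℝ (φ.memLp.toLp _) (dx u)} :=
    isClosed_eq (continuous_const.inner fn.continuous) (continuous_const.inner dx.continuous).neg
  refine dense_ofTest.induction_on u hc fun ψ => ?_
  change inner ℝ (φ.memLp_deriv.toLp _) (fn (ofTest ψ)) =
    -inner ℝ (φ.memLp.toLp _) (dx (ofTest ψ))
  rw [← integral_mul_eq_inner _ φ.memLp_deriv, ← integral_mul_eq_inner _ φ.memLp]
  have e1 : ∫ x, fn (ofTest ψ) x * deriv (φ : ℝ → ℝ) x ∂mu = ∫ x, ψ x * deriv (φ : ℝ → ℝ) x := by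
    rw [← setIntegral_eq_integral_of_forall_compl_eq_zero (s := Ioo (0 : ℝ) 1)
      (f := fun x => ψ x * deriv (φ : ℝ → ℝ) x) (fun x hx => by rw [ψ.eq_zero hx, zero_mul])]
    refine integral_congr_ae ?_
    filter_upwards [fn_ofTest ψ] with x hx
    rw [hx]
  have e2 : ∫ x, dx (ofTest ψ) x * φ x ∂mu = ∫ x, deriv (ψ : ℝ → ℝ) x * φ x := by
    rw [← setIntegral_eq_integral_of_forall_compl_eq_zero (s := Ioo (0 : ℝ) 1)
      (f := fun x => deriv (ψ : ℝ → ℝ) x * φ x) (fun x hx => by rw [φ.eq_zero hx, mul_zero])]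
    refine integral_congr_ae ?_
    filter_upwards [dx_ofTest ψ] with x hx
    rw [hx]
  rw [e1, e2]
  refine integral_mul_deriv_eq_deriv_mul_of_integrable
    (fun x _ => (ψ.differentiable x).hasDerivAt) (fun x _ => (φ.differentiable x).hasDerivAt) ?_ ?_ ?_
  · exact (ψ.continuous.mul φ.continuous_deriv).integrable_of_hasCompactSupport
      ψ.hasCompactSupport.mul_right
  · exact (ψ.continuous_deriv.mul φ.continuous).integrable_of_hasCompactSupport
      φ.hasCompactSupport.mul_left
  · exact (ψ.continuous.mul φ.continuous).integrable_of_hasCompactSupport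
      ψ.hasCompactSupport.mul_right

/-- An element of `H_0^1(0,1)` is determined by its underlying function. -/
lemma eq_zero_of_fn_eq_zero (u : H01) (h : fn u = 0) : u = 0 := by
  have hd : dx u = 0 := by
    have hint : Integrable (dx u) mu := (Lp.memLp (dx u)).integrable (by norm_num)
    have h1 := isOpen_Ioo.ae_eq_zero_of_integral_contDiff_smul_eq_zero (U := Ioo (0 : ℝ) 1)
      (f := dx u) (μ := mu) (hint.integrableOn.locallyIntegrableOn) ?_
    · rw [Lp.eq_zero_iff_ae_eq_zero]
      filter_upwards [h1, ae_restrict_mem measurableSet_Ioo] with x hx hx'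
      exact hx hx'
    · intro g hg hgc hgs
      have h2 := isWeakDeriv u ⟨g, hg, hgc, hgs⟩
      rw [integral_mul_eq_inner _ (Test.memLp_deriv _), h, inner_zero_right] at h2
      have h3 : ∫ x, dx u x * g x ∂mu = 0 := neg_eq_zero.1 h2.symm
      simpa [mul_comm] using h3
  apply Subtype.ext
  apply WithLp.ofLp_injective
  exact Prod.ext h hd

/-- The embedding `H_0^1(0,1) ⊂ L²(0,1) ⊂ H^{-1}(0,1)`, `⟨ι u, φ⟩ = ∫ u φ`. -/
def incl : H01 →ₗ[ℝ] Hm1 where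
  toFun u := innerSL ℝ (fn u) ∘L fn
  map_add' u v := by ext w; simp
  map_smul' c u := by ext w; simp

lemma incl_apply (u v : H01) : incl u v = ∫ x, fn u x * fn v x ∂mu := by
  change inner ℝ (fn u) (fn v) = _
  rw [L2.inner_def]
  exact integral_congr_ae (Eventually.of_forall fun x => mul_comm _ _)

lemma incl_injective : Function.Injective incl := by
  rw [injective_iff_map_eq_zero]
  intro u hu
  apply eq_zero_of_fn_eq_zero
  have h : inner ℝ (fn u) (fn u) = (0 : ℝ) := DFunLike.congr_fun hu u
  exact inner_self_eq_zero.1 h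

/-- The operator `A = -∂_xx : H_0^1(0,1) → H^{-1}(0,1)`, where the second derivative is taken in
the sense of distributions: `⟨A u, φ⟩ = ∫ u' φ'`. -/
def opA : H01 →ₗ[ℝ] Hm1 where
  toFun u := innerSL ℝ (dx u) ∘L dx
  map_add' u v := by ext w; simp
  map_smul' c u := by ext w; simp

lemma opA_apply (u v : H01) : opA u v = ∫ x, dx u x * dx v x ∂mu := by
  change inner ℝ (dx u) (dx v) = _
  rw [L2.inner_def]
  exact integral_congr_ae (Eventually.of_forall fun x => mul_comm _ _)

/-- The operator `B u = -4n ∑_{k=1}^{n-1} δ_{k/n} u`, where `δ_x u = u(x) δ_x`. -/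
def opB (n : ℕ) : H01 →ₗ[ℝ] Hm1 :=
  -((4 * n : ℝ) • ∑ k ∈ Finset.Ico 1 n,
    (dirac ((k : ℝ) / n) : H01 →ₗ[ℝ] ℝ).smulRight (dirac ((k : ℝ) / n)))

lemma opB_apply (n : ℕ) (u v : H01) :
    opB n u v = -(4 * n * ∑ k ∈ Finset.Ico 1 n, eval u ((k : ℝ) / n) * eval v ((k : ℝ) / n)) := by
  simp [opB, dirac_apply]

/-- The linearized operator `L = A + B : H_0^1(0,1) → H^{-1}(0,1)`. -/
def opL (n : ℕ) : H01 →ₗ[ℝ] Hm1 := opA + opB n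

/-- The solutions `U ∈ H_0^1(0,1)` of `L U = λ U` in `H^{-1}(0,1)`. -/
def eigenspace (n : ℕ) (l : ℝ) : Submodule ℝ H01 := LinearMap.ker (opL n - l • incl)

lemma mem_eigenspace (n : ℕ) (l : ℝ) (u : H01) : u ∈ eigenspace n l ↔ opL n u = l • incl u := by
  simp [eigenspace, sub_eq_zero]

/-- `l` is an eigenvalue of `L`, regarded as an operator in `H^{-1}(0,1)` with domain
`H_0^1(0,1)`. -/
def IsEigenvalue (n : ℕ) (l : ℝ) : Prop := ∃ u : H01, u ≠ 0 ∧ opL n u = l • incl u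

end DiracLinearization

end

noncomputable section

namespace DiracLinearization

/-! The form `⟨Lu, u⟩ = ∫ u'² - 4n ∑ u(k/n)²` is symmetric, and nonnegative when `u` vanishes at the
`n - 1` nodes. Negative eigenvectors are therefore controlled by their node values: each negative
eigenspace embeds in `ℝ^(n-1)`, and there are at most `n - 1` negative eigenvalues.

The other two claims reduce to recurrences on node values. If `p'' = κ p` and `p 0 = 0`, gluing two
copies of `p` over adjacent cells gives a hat `h` for which `-h'' + κ h` is a combination of Dirac
masses at three consecutive nodes (`exists_hat`). With `κ = 0`, testing `Lu = 0` against the hats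
gives a recurrence with double root `-1`, whose only Dirichlet solution is zero; then the delta
terms drop out and `∫ u'² = 0`. With `κ = s²`, `p = sinh (s x)` and `s = n t`, the sum of hats
weighted by `sin (k π/n)` is an eigenvector for `-s²` once `t (cosh t - cos (π/n)) = 2 sinh t`,
which has a positive root.

Hats are placed in `H01` through their derivatives, by `exists_dx_eq`. -/

/-! ### Mean-zero functions as derivatives -/

lemma integral_mu_eq (f : ℝ → ℝ) : ∫ x, f x ∂mu = ∫ x in (0 : ℝ)..1, f x := by
  rw [intervalIntegral.integral_of_le zero_le_one, integral_Ioc_eq_integral_Ioo]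

/-- A test function of mean zero is the derivative of a test function. -/
lemma Test.exists_deriv_eq (g : Test) (hg : ∫ x, g x ∂mu = 0) :
    ∃ φ : Test, deriv (φ : ℝ → ℝ) = g := by
  obtain ⟨a, b, ha, hb, hK⟩ : ∃ a b : ℝ, 0 < a ∧ b < 1 ∧ tsupport (g : ℝ → ℝ) ⊆ Icc a b := by
    -- Adjoining `1/2` keeps the compact set nonempty when `g = 0`.
    have hc : IsCompact (insert (1 / 2 : ℝ) (tsupport (g : ℝ → ℝ))) :=
      IsCompact.insert g.hasCompactSupport _
    have hs : insert (1 / 2 : ℝ) (tsupport (g : ℝ → ℝ)) ⊆ Ioo 0 1 :=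
      insert_subset (by norm_num) g.tsupport_subset
    obtain ⟨a, ha, ha'⟩ := hc.exists_isLeast (insert_nonempty _ _)
    obtain ⟨b, hb, hb'⟩ := hc.exists_isGreatest (insert_nonempty _ _)
    exact ⟨a, b, (hs ha).1, (hs hb).2, fun x hx =>
      ⟨ha' (mem_insert_of_mem _ hx), hb' (mem_insert_of_mem _ hx)⟩⟩
  have h0 : ∀ x, x ∉ Icc a b → g x = 0 := fun x hx =>
    image_eq_zero_of_notMem_tsupport fun h => hx (hK h)
  have hd : ∀ x, HasDerivAt (fun x => ∫ t in (0 : ℝ)..x, g t) (g x) x := fun x =>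
    intervalIntegral.integral_hasDerivAt_right (g.continuous.intervalIntegrable _ _)
      (g.continuous.stronglyMeasurableAtFilter _ _) g.continuous.continuousAt
  have hderiv : deriv (fun x => ∫ t in (0 : ℝ)..x, g t) = g := funext fun x => (hd x).deriv
  have hsupp : Function.support (fun x => ∫ t in (0 : ℝ)..x, g t) ⊆ Icc a b := by
    intro x hx
    by_contra hxab
    apply hx
    rw [mem_Icc, not_and_or, not_le, not_le] at hxab
    rcases hxab with h | h
    · refine (intervalIntegral.integral_congr (g := fun _ => (0 : ℝ)) fun t ht => ?_).trans (by simp)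
      refine h0 t fun hm => ?_
      have := hm.1
      have : t ≤ max 0 x := ht.2
      have : max 0 x < a := max_lt ha h
      linarith
    · have h1 : ∫ t in (1 : ℝ)..x, g t = 0 := by
        refine (intervalIntegral.integral_congr (g := fun _ => (0 : ℝ)) fun t ht => ?_).trans
          (by simp)
        refine h0 t fun hm => ?_
        have := hm.2
        have : min 1 x ≤ t := ht.1
        have : b < min 1 x := lt_min hb h
        linarith
      change ∫ t in (0 : ℝ)..x, g t = 0
      rw [← intervalIntegral.integral_add_adjacent_intervals
        (g.continuous.intervalIntegrable 0 1) (g.continuous.intervalIntegrable 1 x), h1,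
        ← integral_mu_eq, hg, add_zero]
  have hts : tsupport (fun x => ∫ t in (0 : ℝ)..x, g t) ⊆ Icc a b :=
    closure_minimal hsupp isClosed_Icc
  refine ⟨⟨fun x => ∫ t in (0 : ℝ)..x, g t, ?_, ?_, ?_⟩, hderiv⟩
  · refine contDiff_infty_iff_deriv.2 ⟨fun x => (hd x).differentiableAt, ?_⟩
    rw [hderiv]
    exact g.contDiff_infty
  · exact HasCompactSupport.of_support_subset_isCompact isCompact_Icc hsupp
  · exact hts.trans fun x hx => ⟨ha.trans_le hx.1, hx.2.trans_lt hb⟩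

lemma Test.exists_integral_eq_one : ∃ ψ : Test, ∫ x, ψ x ∂mu = 1 := by
  let f : ContDiffBump (1 / 2 : ℝ) := ⟨1 / 8, 1 / 4, by norm_num, by norm_num⟩
  have hsub : tsupport (f.normed volume) ⊆ Ioo (0 : ℝ) 1 := by
    rw [f.tsupport_normed_eq, Real.closedBall_eq_Icc]
    intro x hx
    simp only [f, mem_Icc] at hx
    constructor <;> linarith [hx.1, hx.2]
  refine ⟨⟨f.normed volume, f.contDiff_normed, f.hasCompactSupport_normed, hsub⟩, ?_⟩
  change ∫ x, f.normed volume x ∂mu = 1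
  rw [setIntegral_eq_integral_of_forall_compl_eq_zero
    (fun x hx => image_eq_zero_of_notMem_tsupport fun h => hx (hsub h)), f.integral_normed]

lemma Lp.integrable_mu (v : L2) : Integrable v mu := (Lp.memLp v).integrable (by norm_num)

lemma Test.integrable_mul (φ : Test) (v : L2) : Integrable (fun x => v x * φ x) mu :=
  (Lp.memLp v).integrable_mul φ.memLp

lemma Test.integrable (φ : Test) : Integrable φ mu := φ.memLp.integrable (by norm_num)

/-- The du Bois-Reymond lemma. -/
lemma ae_eq_const_of_integral_mul_deriv_eq_zero (v : L2)
    (hv : ∀ φ : Test, ∫ x, v x * deriv (φ : ℝ → ℝ) x ∂mu = 0) :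
    ∃ c : ℝ, ∀ᵐ x ∂mu, v x = c := by
  obtain ⟨ψ, hψ⟩ := Test.exists_integral_eq_one
  set c := ∫ x, v x * ψ x ∂mu with hc
  -- Subtracting `(∫ g) • ψ` leaves a test function of mean zero, hence a derivative, which `v`
  -- annihilates.
  have key : ∀ g : Test, ∫ x, v x * g x ∂mu = c * ∫ x, g x ∂mu := by
    intro g
    have hm : ∫ x, (g - (∫ x, g x ∂mu) • ψ : Test) x ∂mu = 0 := by
      change ∫ x, (g x - (∫ x, g x ∂mu) * ψ x) ∂mu = 0
      rw [integral_sub g.integrable (ψ.integrable.const_mul _), integral_const_mul, hψ]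
      ring
    obtain ⟨φ, hφ⟩ := Test.exists_deriv_eq _ hm
    have h := hv φ
    rw [hφ] at h
    have h' : ∫ x, (v x * g x - (∫ x, g x ∂mu) * (v x * ψ x)) ∂mu = 0 := by
      rw [← h]
      refine integral_congr_ae (Eventually.of_forall fun x => ?_)
      change _ = v x * (g x - (∫ x, g x ∂mu) * ψ x)
      ring
    rw [integral_sub (g.integrable_mul v) ((ψ.integrable_mul v).const_mul _),
      integral_const_mul] at h'
    linarith
  refine ⟨c, ?_⟩
  have h1 := isOpen_Ioo.ae_eq_zero_of_integral_contDiff_smul_eq_zero (U := Ioo (0 : ℝ) 1)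
    (f := fun x => v x - c) (μ := mu)
    (((Lp.integrable_mu v).sub (integrable_const c)).integrableOn.locallyIntegrableOn) ?_
  · filter_upwards [h1, ae_restrict_mem measurableSet_Ioo] with x hx hx'
    exact sub_eq_zero.1 (hx hx')
  · intro g hg hgc hgs
    let G : Test := ⟨g, hg, hgc, hgs⟩
    have h2 := key G
    have h3 : ∫ x, (v x * G x - c * G x) ∂mu = 0 := by
      rw [integral_sub (G.integrable_mul v) (G.integrable.const_mul c), integral_const_mul, h2,
        sub_self]
    rw [← h3]
    refine integral_congr_ae (Eventually.of_forall fun x => ?_)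
    change g x * (v x - c) = v x * g x - c * g x
    ring

/-- Poincaré inequality: `u(x)` is the inner product of `u'` with an indicator of norm at most 1, so
Cauchy–Schwarz bounds it pointwise. -/
lemma norm_fn_le (u : H01) : ‖fn u‖ ≤ ‖dx u‖ := by
  have hb : ∀ x, ‖eval u x‖ ≤ ‖dx u‖ := by
    intro x
    rw [← dirac_apply]
    refine (norm_inner_le_norm (𝕜 := ℝ) _ (dx u)).trans ?_
    have h : ‖indicatorConstLp (μ := mu) 2 (measurableSet_Iic (a := x)) (measure_ne_top mu _)
        (1 : ℝ)‖ ≤ 1 := by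
      refine norm_indicatorConstLp_le.trans ?_
      rw [norm_one, one_mul]
      refine Real.rpow_le_one measureReal_nonneg ?_ (by positivity)
      refine (measureReal_mono (subset_univ _)).trans ?_
      simp [Measure.real]
    calc _ ≤ 1 * ‖dx u‖ := by gcongr
      _ = _ := one_mul _
  have h := Lp.norm_le_of_ae_bound (f := fn u) (C := ‖dx u‖) (norm_nonneg _) (by
    filter_upwards [fn_ae_eq_eval u] with x hx
    rw [hx]
    exact hb x)
  refine h.trans ?_
  have : measureUnivNNReal mu = 1 := by
    simp [measureUnivNNReal]
  rw [this]
  simp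

lemma eq_zero_of_dx_eq_zero (u : H01) (h : dx u = 0) : u = 0 := by
  apply eq_zero_of_fn_eq_zero
  have := norm_fn_le u
  rw [h, norm_zero] at this
  exact norm_le_zero_iff.1 this

instance : CompleteSpace H01 :=
  (Submodule.isClosed_topologicalClosure (LinearMap.range testPair)).completeSpace_coe

/-- By Poincaré `‖u‖² ≤ 2 ‖u'‖²`, so `dx` is bounded below on a complete space. -/
lemma isClosed_range_dx : IsClosed (range dx) := by
  refine AntilipschitzWith.isClosed_range (f := dx) (K := 2) ?_ dx.uniformContinuous
  refine AddMonoidHomClass.antilipschitz_of_bound dx fun u => ?_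
  have h1 : ‖u‖ ^ 2 = ‖fn u‖ ^ 2 + ‖dx u‖ ^ 2 := WithLp.prod_norm_sq_eq_of_L2 (u : L2Pair)
  have h2 := norm_fn_le u
  have h3 := norm_nonneg (fn u)
  rw [NNReal.coe_ofNat]
  refine abs_le_of_sq_le_sq' ?_ (by positivity) |>.2
  nlinarith

/-- Every function of mean zero in `L²(0,1)` is the derivative of an element of `H_0^1(0,1)`. -/
lemma exists_dx_eq (v : L2) (hv : ∫ x, v x ∂mu = 0) : ∃ u : H01, dx u = v := by
  let K : Submodule ℝ L2 := LinearMap.range (dx : H01 →ₗ[ℝ] L2)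
  have hK : IsClosed (K : Set L2) := isClosed_range_dx
  have : CompleteSpace K := hK.completeSpace_coe
  -- By du Bois-Reymond, anything orthogonal to all derivatives is constant, hence orthogonal to
  -- `v`; closedness of `K` then gives `v ∈ K`.
  have : v ∈ Kᗮᗮ := by
    rw [Submodule.mem_orthogonal]
    intro w hw
    rw [Submodule.mem_orthogonal] at hw
    obtain ⟨c, hc⟩ := ae_eq_const_of_integral_mul_deriv_eq_zero w fun φ => by
      rw [← hw (dx (ofTest φ)) ⟨ofTest φ, rfl⟩, integral_mul_eq_inner w φ.memLp_deriv]
      rfl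
    rw [L2.inner_def]
    calc _ = ∫ x, c * v x ∂mu := by
          refine integral_congr_ae ?_
          filter_upwards [hc] with x hx
          simp [hx, mul_comm]
      _ = 0 := by rw [integral_const_mul, hv, mul_zero]
  rw [Submodule.orthogonal_orthogonal] at this
  obtain ⟨u, hu⟩ := this
  exact ⟨u, hu⟩

/-! ### Hat functions -/

lemma memLp_mu_of_continuous {f : ℝ → ℝ} (hf : Continuous f) : MemLp f 2 mu := by
  obtain ⟨C, hC⟩ := isCompact_Icc.exists_bound_of_continuousOn (s := Icc (0 : ℝ) 1) hf.continuousOn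
  refine MemLp.of_bound hf.aestronglyMeasurable C ?_
  filter_upwards [ae_restrict_mem measurableSet_Ioo] with x hx
  exact hC x ⟨hx.1.le, hx.2.le⟩

lemma integral_indicator_Ioc_mul (f g : ℝ → ℝ) {a b : ℝ} (ha : 0 ≤ a) (hab : a ≤ b) (hb : b ≤ 1) :
    ∫ x, (Ioc a b).indicator f x * g x ∂mu = ∫ x in a..b, f x * g x := by
  have h : ∀ x, (Ioc a b).indicator f x * g x = (Ioc a b).indicator (fun x => f x * g x) x :=
    fun x => (indicator_mul_left _ _ _).symm
  simp_rw [h]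
  rw [mu, restrict_Ioo_eq_restrict_Ioc, setIntegral_indicator measurableSet_Ioc,
    inter_eq_right.2 (Ioc_subset_Ioc ha hb), intervalIntegral.integral_of_le hab]

/-- Clamping `x` to `[a, b]` by `max a (min b x)` gives one formula covering all positions of `x`.
-/
lemma setIntegral_Iic_indicator_Ioc (f : ℝ → ℝ) {a b : ℝ} (ha : 0 ≤ a) (hab : a ≤ b) (hb : b ≤ 1)
    (x : ℝ) :
    ∫ t in Iic x, (Ioc a b).indicator f t ∂mu = ∫ t in a..max a (min b x), f t := by
  have h : Iic x ∩ Ioc a b = Ioc a (max a (min b x)) := by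
    ext t
    simp only [mem_inter_iff, mem_Iic, mem_Ioc, le_max_iff, le_min_iff]
    grind
  have h2 : max a (min b x) ≤ 1 := max_le (hab.trans hb) ((min_le_left _ _).trans hb)
  rw [setIntegral_indicator measurableSet_Ioc, h, mu, restrict_Ioo_eq_restrict_Ioc,
    Measure.restrict_restrict measurableSet_Ioc, inter_eq_left.2 (Ioc_subset_Ioc ha h2),
    intervalIntegral.integral_of_le (le_max_left _ _)]

lemma integral_mul_deriv_test_eq {p q : ℝ → ℝ} {κ : ℝ} (hq : ∀ x, HasDerivAt q (κ * p x) x)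
    (hp : Continuous p) (φ : Test) (a b : ℝ) :
    ∫ x in a..b, q x * deriv (φ : ℝ → ℝ) x =
      q b * φ b - q a * φ a - κ * ∫ x in a..b, p x * φ x := by
  rw [intervalIntegral.integral_mul_deriv_eq_deriv_mul (fun x _ => hq x)
    (fun x _ => (φ.differentiable x).hasDerivAt)
    ((continuous_const.mul hp).intervalIntegrable _ _) (φ.continuous_deriv.intervalIntegrable _ _),
    ← intervalIntegral.integral_const_mul]
  simp only [mul_assoc]

/-- For a solution `p` of `p'' = κ p`, `p 0 = 0`, the hat function equal to `p (x - a)` on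
`[a, b]`, to `p (c - x)` on `[b, c]` and to `0` elsewhere, where `b` is the midpoint of `[a, c]`. -/
lemma exists_hat {p q : ℝ → ℝ} {κ : ℝ} (hp : ∀ x, HasDerivAt p (q x) x)
    (hq : ∀ x, HasDerivAt q (κ * p x) x) (hp0 : p 0 = 0) {a b c d : ℝ} (hd : 0 ≤ d)
    (hab : b = a + d) (hbc : c = b + d) (ha : 0 ≤ a) (hc : c ≤ 1) :
    ∃ h : H01, (∀ φ : H01, opA h φ + κ * incl h φ =
        2 * q d * eval φ b - q 0 * (eval φ a + eval φ c)) ∧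
      eval h b = p d ∧ (∀ x ≤ a, eval h x = 0) ∧ ∀ x, c ≤ x → eval h x = 0 := by
  have hpc : Continuous p := continuous_iff_continuousAt.2 fun x => (hp x).continuousAt
  have hqc : Continuous q := continuous_iff_continuousAt.2 fun x => (hq x).continuousAt
  have hab' : a ≤ b := by linarith
  have hbc' : b ≤ c := by linarith
  have hb0 : 0 ≤ b := ha.trans hab'
  have hb1 : b ≤ 1 := hbc'.trans hc
  set f₁ : ℝ → ℝ := fun x => q (x - a) with hf₁
  set f₂ : ℝ → ℝ := fun x => q (c - x) with hf₂
  have hf₁c : Continuous f₁ := by fun_prop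
  have hf₂c : Continuous f₂ := by fun_prop
  have hm₁ : MemLp ((Ioc a b).indicator f₁) 2 mu :=
    (memLp_mu_of_continuous hf₁c).indicator measurableSet_Ioc
  have hm₂ : MemLp ((Ioc b c).indicator f₂) 2 mu :=
    (memLp_mu_of_continuous hf₂c).indicator measurableSet_Ioc
  have hP₁ : ∀ x y, ∫ t in x..y, f₁ t = p (y - a) - p (x - a) := fun x y =>
    intervalIntegral.integral_eq_sub_of_hasDerivAt (f := fun t => p (t - a))
      (fun t _ => (hp (t - a)).comp_sub_const t a) (hf₁c.intervalIntegrable _ _)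
  have hP₂ : ∀ x y, ∫ t in x..y, f₂ t = p (c - x) - p (c - y) := fun x y => by
    rw [intervalIntegral.integral_eq_sub_of_hasDerivAt (f := fun t => -p (c - t)) (f' := f₂)
      (fun t _ => ((hp (c - t)).comp_const_sub c t).neg.congr_deriv (neg_neg _))
      (hf₂c.intervalIntegrable _ _)]
    ring
  have hint₁ : Integrable ((Ioc a b).indicator f₁) mu := hm₁.integrable (by norm_num)
  have hint₂ : Integrable ((Ioc b c).indicator f₂) mu := hm₂.integrable (by norm_num)
  have e1 : b - a = d := by linarith
  have e2 : c - b = d := by linarith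
  -- The derivative of the hat. Its mean is zero because both halves have length `d` and integrate
  -- to `p d`.
  set v : L2 := (hm₁.sub hm₂).toLp _ with hv
  have hvae : ∀ᵐ x ∂mu, v x = (Ioc a b).indicator f₁ x - (Ioc b c).indicator f₂ x :=
    (hm₁.sub hm₂).coeFn_toLp
  have hv0 : ∫ x, v x ∂mu = 0 := by
    rw [integral_congr_ae hvae, integral_sub hint₁ hint₂]
    have i1 := integral_indicator_Ioc_mul f₁ (fun _ => 1) ha hab' hb1
    have i2 := integral_indicator_Ioc_mul f₂ (fun _ => 1) hb0 hbc' hc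
    simp only [mul_one] at i1 i2
    rw [i1, i2, hP₁, hP₂]
    simp [e1, e2, hp0]
  obtain ⟨h, hh⟩ := exists_dx_eq v hv0
  have heval : ∀ x, eval h x = p (max a (min b x) - a) + p (c - max b (min c x)) - p d := by
    intro x
    rw [eval, hh, integral_congr_ae (ae_restrict_of_ae hvae),
      integral_sub hint₁.integrableOn hint₂.integrableOn,
      setIntegral_Iic_indicator_Ioc f₁ ha hab' hb1, setIntegral_Iic_indicator_Ioc f₂ hb0 hbc' hc,
      hP₁, hP₂, e2, sub_self, hp0]
    ring
  have hl : ∀ x ≤ a, eval h x = 0 := fun x hx => by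
    rw [heval, min_eq_right (hx.trans hab'), max_eq_left hx,
      min_eq_right (hx.trans (hab'.trans hbc')), max_eq_left (hx.trans hab'), e2, sub_self, hp0]
    ring
  have hr : ∀ x, c ≤ x → eval h x = 0 := fun x hx => by
    rw [heval, min_eq_left (hbc'.trans hx), max_eq_right hab', min_eq_left hx, max_eq_right hbc',
      e1, sub_self, hp0]
    ring
  have hL : ∀ x ∈ Icc a b, eval h x = p (x - a) := fun x hx => by
    rw [heval, min_eq_right hx.2, max_eq_right hx.1, min_eq_right (hx.2.trans hbc'),
      max_eq_left hx.2, e2]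
    ring
  have hR : ∀ x ∈ Icc b c, eval h x = p (c - x) := fun x hx => by
    rw [heval, min_eq_left hx.1, max_eq_right hab', min_eq_right hx.2, max_eq_right hx.1, e1]
    ring
  refine ⟨h, fun φ => ?_, ?_, hl, hr⟩
  -- Both sides are continuous in `φ`, so test functions suffice; for them one integrates by parts
  -- on each half.
  · have hcl : IsClosed {φ : H01 | opA h φ + κ * incl h φ =
        2 * q d * eval φ b - q 0 * (eval φ a + eval φ c)} := by
      simp only [← dirac_apply]
      exact isClosed_eq (by fun_prop) (by fun_prop)
    refine dense_ofTest.induction_on φ hcl fun φ => ?_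
    change opA h (ofTest φ) + κ * incl h (ofTest φ) = 2 * q d * eval (ofTest φ) b -
      q 0 * (eval (ofTest φ) a + eval (ofTest φ) c)
    simp only [eval_ofTest]
    have hi₁ : Integrable (fun x => (Ioc a b).indicator f₁ x * deriv (φ : ℝ → ℝ) x) mu :=
      hm₁.integrable_mul φ.memLp_deriv
    have hi₂ : Integrable (fun x => (Ioc b c).indicator f₂ x * deriv (φ : ℝ → ℝ) x) mu :=
      hm₂.integrable_mul φ.memLp_deriv
    have hA : opA h (ofTest φ) = (∫ x in a..b, f₁ x * deriv (φ : ℝ → ℝ) x) -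
        ∫ x in b..c, f₂ x * deriv (φ : ℝ → ℝ) x := by
      rw [opA_apply, hh, ← integral_indicator_Ioc_mul _ _ ha hab' hb1,
        ← integral_indicator_Ioc_mul _ _ hb0 hbc' hc,
        ← integral_sub hi₁ hi₂]
      refine integral_congr_ae ?_
      filter_upwards [hvae, dx_ofTest φ] with x h1 h2
      rw [h1, h2, sub_mul]
    have hI : incl h (ofTest φ) = (∫ x in a..b, p (x - a) * φ x) +
        ∫ x in b..c, p (c - x) * φ x := by
      have hc' : Continuous fun x => eval h x * φ x := (continuous_eval h).mul φ.continuous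
      have z1 : ∫ x in (0 : ℝ)..a, eval h x * φ x = 0 := by
        refine (intervalIntegral.integral_congr (g := fun _ => (0 : ℝ)) fun t ht => ?_).trans
          (by simp)
        rw [uIcc_of_le ha] at ht
        simp [hl t ht.2]
      have z2 : ∫ x in c..(1 : ℝ), eval h x * φ x = 0 := by
        refine (intervalIntegral.integral_congr (g := fun _ => (0 : ℝ)) fun t ht => ?_).trans
          (by simp)
        rw [uIcc_of_le hc] at ht
        simp [hr t ht.1]
      have z3 : ∫ x in a..b, eval h x * φ x = ∫ x in a..b, p (x - a) * φ x := by
        refine intervalIntegral.integral_congr fun t ht => ?_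
        rw [uIcc_of_le hab'] at ht
        simp [hL t ht]
      have z4 : ∫ x in b..c, eval h x * φ x = ∫ x in b..c, p (c - x) * φ x := by
        refine intervalIntegral.integral_congr fun t ht => ?_
        rw [uIcc_of_le hbc'] at ht
        simp [hR t ht]
      have hae : (fun x => fn h x * fn (ofTest φ) x) =ᵐ[mu] fun x => eval h x * φ x := by
        filter_upwards [fn_ae_eq_eval h, fn_ofTest φ] with x h1 h2
        rw [h1, h2]
      rw [incl_apply, integral_congr_ae hae, integral_mu_eq,
        ← intervalIntegral.integral_add_adjacent_intervals
          (hc'.intervalIntegrable 0 c) (hc'.intervalIntegrable c 1),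
        ← intervalIntegral.integral_add_adjacent_intervals
          (hc'.intervalIntegrable 0 b) (hc'.intervalIntegrable b c),
        ← intervalIntegral.integral_add_adjacent_intervals
          (hc'.intervalIntegrable 0 a) (hc'.intervalIntegrable a b), z1, z2, z3, z4]
      ring
    have p1 := integral_mul_deriv_test_eq (p := fun x => p (x - a)) (q := f₁) (κ := κ)
      (fun x => (hq (x - a)).comp_sub_const x a) (by fun_prop) φ a b
    -- Reflection flips the sign: the derivative of `q (c - x)` is `-κ p (c - x)`. The two boundary
    -- terms at `b` then add up to `2 q d`, and the zero-order terms cancel `κ * incl h`.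
    have p2 := integral_mul_deriv_test_eq (p := fun x => -p (c - x)) (q := f₂) (κ := κ)
      (fun x => by simpa using (hq (c - x)).comp_const_sub c x) (by fun_prop) φ b c
    simp only [neg_mul, intervalIntegral.integral_neg] at p2
    rw [hA, hI, p1, p2]
    simp only [hf₁, hf₂, e1, e2, sub_self]
    ring
  · rw [hL b ⟨hab', le_rfl⟩, e1]

/-! ### Finiteness of the negative spectrum -/

lemma opA_comm (u v : H01) : opA u v = opA v u := real_inner_comm (dx v) (dx u)

lemma incl_comm (u v : H01) : incl u v = incl v u := real_inner_comm (fn v) (fn u)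

lemma opL_apply (n : ℕ) (u v : H01) : opL n u v = opA u v + opB n u v := rfl

lemma opL_comm (n : ℕ) (u v : H01) : opL n u v = opL n v u := by
  simp only [opL_apply, opA_comm u v, opB_apply, mul_comm (eval u _)]

lemma opA_self_nonneg (u : H01) : 0 ≤ opA u u := real_inner_self_nonneg (x := dx u)

lemma incl_self_nonneg (u : H01) : 0 ≤ incl u u := real_inner_self_nonneg (x := fn u)

lemma incl_self_pos {u : H01} (hu : u ≠ 0) : 0 < incl u u :=
  lt_of_le_of_ne (incl_self_nonneg u) fun h =>
    hu (eq_zero_of_fn_eq_zero u (inner_self_eq_zero.1 h.symm))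

/-- The values of `u` at the points `k/n`, `1 ≤ k ≤ n - 1`. -/
def nodeValues (n : ℕ) : H01 →ₗ[ℝ] (Finset.Ico 1 n → ℝ) :=
  LinearMap.pi fun k => (dirac ((k : ℝ) / n) : H01 →ₗ[ℝ] ℝ)

lemma nodeValues_apply (n : ℕ) (u : H01) (k : Finset.Ico 1 n) :
    nodeValues n u k = eval u ((k : ℝ) / n) := dirac_apply _ _

lemma opL_self_nonneg_of_nodeValues_eq_zero {n : ℕ} {u : H01} (h : nodeValues n u = 0) :
    0 ≤ opL n u u := by
  have hB : opB n u u = 0 := by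
    rw [opB_apply, Finset.sum_eq_zero, mul_zero, neg_zero]
    intro k hk
    rw [← nodeValues_apply n u ⟨k, hk⟩, h, Pi.zero_apply, zero_mul]
  rw [opL_apply, hB, add_zero]
  exact opA_self_nonneg u

/-- `nodeValues` is injective here: a nonzero eigenvector in its kernel would make the form both
nonnegative and negative. -/
lemma finiteDimensional_eigenspace (n : ℕ) {l : ℝ} (hl : l < 0) :
    FiniteDimensional ℝ (eigenspace n l) := by
  refine FiniteDimensional.of_injective (nodeValues n ∘ₗ (eigenspace n l).subtype) ?_
  rw [injective_iff_map_eq_zero]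
  rintro ⟨u, hu⟩ h0
  rw [mem_eigenspace] at hu
  by_contra hne
  have h1 := opL_self_nonneg_of_nodeValues_eq_zero (n := n) (u := u) h0
  rw [hu] at h1
  have h2 : 0 < incl u u := incl_self_pos fun h => hne (Subtype.ext h)
  have h3 : 0 ≤ l * incl u u := h1
  nlinarith

lemma incl_eq_zero_of_eigenvalue_ne {n : ℕ} {l m : ℝ} (hlm : l ≠ m) {u v : H01}
    (hu : opL n u = l • incl u) (hv : opL n v = m • incl v) : incl u v = 0 := by
  have h1 : opL n u v = l * incl u v := by rw [hu]; rfl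
  have h2 : opL n v u = m * incl v u := by rw [hv]; rfl
  rw [opL_comm, h2, incl_comm] at h1
  have h3 : (m - l) * incl u v = 0 := by linarith
  exact (mul_eq_zero.1 h3).resolve_left (sub_ne_zero.2 hlm.symm)

/-- With more than `n - 1` eigenvalues, some nontrivial combination of eigenvectors vanishes at
every node. Orthogonality makes the form diagonal on it, hence negative: a contradiction. -/
lemma card_le_of_negative_eigenvalues {n : ℕ} (T : Finset ℝ)
    (hT : ∀ l ∈ T, l < 0 ∧ IsEigenvalue n l) : T.card ≤ n - 1 := by
  by_contra! hcard
  choose! u hu0 hu using fun l hl => (hT l hl).2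
  let S : (T → ℝ) →ₗ[ℝ] H01 := Fintype.linearCombination ℝ fun l : T => u l
  have hS : ∀ c, S c = ∑ l : T, c l • u l := fun c => Fintype.linearCombination_apply ..
  have hker := LinearMap.ker_ne_bot_of_finrank_lt (f := nodeValues n ∘ₗ S)
    (by simpa using hcard)
  obtain ⟨c, hc, hc0⟩ := Submodule.exists_mem_ne_zero_of_ne_bot hker
  have h1 := opL_self_nonneg_of_nodeValues_eq_zero (n := n) (u := S c) hc
  have h2 : opL n (S c) (S c) = ∑ l : T, c l ^ 2 * (l * incl (u l) (u l)) := by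
    have e : ∀ l m : T, opL n (u l) (u m) = if l = m then (l : ℝ) * incl (u l) (u l) else 0 := by
      intro l m
      have h : opL n (u l) (u m) = l * incl (u l) (u m) := by rw [hu l l.2]; rfl
      split_ifs with hlm
      · rw [h, hlm]
      · rw [h, incl_eq_zero_of_eigenvalue_ne (fun h => hlm (Subtype.ext h)) (hu l l.2) (hu m m.2),
          mul_zero]
    simp only [hS, map_sum, map_smul, sum_apply,
      smul_apply, e, smul_eq_mul, mul_ite, mul_zero,
      Finset.sum_ite_eq', Finset.mem_univ, if_true]
    exact Finset.sum_congr rfl fun l _ => by ring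
  obtain ⟨l, hl⟩ := Function.ne_iff.1 hc0
  have h3 : ∀ l : T, c l ^ 2 * (l * incl (u l) (u l)) ≤ 0 := fun l =>
    mul_nonpos_of_nonneg_of_nonpos (sq_nonneg _)
      (mul_nonpos_of_nonpos_of_nonneg (hT l l.2).1.le (incl_self_nonneg _))
  have h4 : c l ^ 2 * (l * incl (u l) (u l)) < 0 :=
    mul_neg_of_pos_of_neg (sq_pos_of_ne_zero hl)
      (mul_neg_of_neg_of_pos (hT l l.2).1 (incl_self_pos (hu0 l l.2)))
  have h5 := Finset.sum_lt_sum (fun l _ => h3 l) ⟨l, Finset.mem_univ l, h4⟩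
  rw [Finset.sum_const_zero] at h5
  linarith

lemma finite_negative_eigenvalues (n : ℕ) : {l : ℝ | l < 0 ∧ IsEigenvalue n l}.Finite := by
  by_contra hinf
  obtain ⟨T, hT, hcard⟩ := Set.Infinite.exists_subset_card_eq hinf n.succ
  have := card_le_of_negative_eigenvalues T fun l hl => hT hl
  omega

/-! ### Node recurrences and the kernel -/

/-- The hat function centred at the node `(k + 1)/n`. -/
lemma exists_hat_nodes {p q : ℝ → ℝ} {κ : ℝ} (hp : ∀ x, HasDerivAt p (q x) x)
    (hq : ∀ x, HasDerivAt q (κ * p x) x) (hp0 : p 0 = 0) (n k : ℕ) (hk : k + 2 ≤ n) :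
    ∃ h : H01, (∀ φ : H01, opA h φ + κ * incl h φ =
        2 * q (1 / n) * eval φ ((k + 1 : ℕ) / n) -
          q 0 * (eval φ (k / n) + eval φ ((k + 2 : ℕ) / n))) ∧
      ∀ j : ℕ, eval h ((j : ℝ) / n) = if j = k + 1 then p (1 / n) else 0 := by
  have hn : (0 : ℝ) < n := by exact_mod_cast (by omega : 0 < n)
  obtain ⟨h, h1, h2, h3, h4⟩ := exists_hat hp hq hp0 (a := k / n) (b := (k + 1 : ℕ) / n)
    (c := (k + 2 : ℕ) / n) (d := 1 / n) (by positivity) (by push_cast; ring)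
    (by push_cast; ring) (by positivity) (by rw [div_le_one hn]; exact_mod_cast hk)
  refine ⟨h, h1, fun j => ?_⟩
  split_ifs with hj
  · rw [hj, h2]
  · rcases lt_or_gt_of_ne hj with hj | hj
    · exact h3 _ (by gcongr; omega)
    · exact h4 _ (by gcongr; omega)

lemma eval_zero_div (u : H01) (n : ℕ) : eval u ((0 : ℕ) / n) = 0 := by
  simpa using (eval_boundary u).1

lemma eval_self_div (u : H01) {n : ℕ} (hn : n ≠ 0) : eval u ((n : ℕ) / n) = 0 := by
  rw [div_self (by exact_mod_cast hn)]
  exact (eval_boundary u).2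

/-- A solution of `x_{k+2} + 2 x_{k+1} + x_k = 0` with `x_0 = x_n = 0` vanishes. -/
lemma eq_zero_of_recurrence {x : ℕ → ℝ} {n : ℕ} (hn : n ≠ 0) (h0 : x 0 = 0) (hxn : x n = 0)
    (h : ∀ k, k + 2 ≤ n → x (k + 2) + 2 * x (k + 1) + x k = 0) : ∀ k ≤ n, x k = 0 := by
  -- The double characteristic root `-1` and `x 0 = 0` leave only multiples of `(-1)^k * k`;
  -- consecutive values are carried together for the second-order induction.
  have key : ∀ k, k + 1 ≤ n → x k = -(-1) ^ k * k * x 1 ∧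
      x (k + 1) = -(-1) ^ (k + 1) * (k + 1) * x 1 := by
    intro k
    induction k with
    | zero => intro _; simp [h0]
    | succ k ih =>
      intro hk
      obtain ⟨i1, i2⟩ := ih (by omega)
      refine ⟨by rw [i2]; push_cast; ring, ?_⟩
      have := h k (by omega)
      rw [i1, i2] at this
      push_cast
      rw [pow_succ] at this
      rw [pow_succ, pow_succ]
      linarith
  obtain ⟨m, rfl⟩ := Nat.exists_eq_succ_of_ne_zero hn
  have hm := (key m le_rfl).2
  have hx1 : x 1 = 0 := by
    rw [show m + 1 = m.succ from rfl, hxn] at hm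
    have h1 : (-(-1) ^ (m + 1) * ((m : ℝ) + 1)) ≠ 0 :=
      mul_ne_zero (neg_ne_zero.2 (pow_ne_zero _ (by norm_num))) (by positivity)
    exact (mul_eq_zero.1 hm.symm).resolve_left h1
  intro k hk
  rcases Nat.lt_or_ge k (m + 1) with hk' | hk'
  · rw [(key k hk').1, hx1, mul_zero]
  · rw [le_antisymm hk hk', hxn]

lemma not_isEigenvalue_zero {n : ℕ} (hn : 2 ≤ n) : ¬ IsEigenvalue n 0 := by
  rintro ⟨u, hu0, hu⟩
  rw [zero_smul] at hu
  have hn0 : (n : ℝ) ≠ 0 := by exact_mod_cast (by omega : n ≠ 0)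
  have hrec : ∀ k : ℕ, k + 2 ≤ n → eval u ((k + 2 : ℕ) / n) + 2 * eval u ((k + 1 : ℕ) / n) +
      eval u (k / n) = 0 := by
    intro k hk
    -- The piecewise linear tent of height `1/n`: its delta term is `4n · (1/n) = 4`, turning the
    -- coefficient `2` of the second difference into `-2`.
    obtain ⟨h, h1, h2⟩ := exists_hat_nodes (p := fun x => x) (q := fun _ => 1) (κ := 0)
      (fun x => hasDerivAt_id x) (fun x => by simpa using hasDerivAt_const x (1 : ℝ)) rfl n k hk
    have h3 : opL n u h = 0 := by rw [hu]; rfl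
    rw [opL_comm, opL_apply, opB_apply] at h3
    have h4 := h1 u
    simp only [h2, ite_mul, zero_mul, Finset.sum_ite_eq', Finset.mem_Ico] at h3
    rw [if_pos (by omega)] at h3
    have h5 : 4 * (n : ℝ) * (1 / n * eval u ((k + 1 : ℕ) / n)) = 4 * eval u ((k + 1 : ℕ) / n) := by
      field_simp
    linarith
  have hz := eq_zero_of_recurrence (x := fun k => eval u ((k : ℝ) / n)) (n := n) (by omega)
    (eval_zero_div u n) (eval_self_div u (by omega)) hrec
  have hB : opB n u u = 0 := by
    rw [opB_apply, Finset.sum_eq_zero, mul_zero, neg_zero]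
    intro k hk
    rw [hz k (Finset.mem_Ico.1 hk).2.le, zero_mul]
  have hA : opA u u = 0 := by
    have : opL n u u = 0 := by rw [hu]; rfl
    rwa [opL_apply, hB, add_zero] at this
  exact hu0 (eq_zero_of_dx_eq_zero u (inner_self_eq_zero.1 hA))

/-! ### A negative eigenvalue -/

/-- Intermediate values on `[1, 4]`: the difference of the sides is `(3 e⁻¹ - e)/2 - r < 0` at 1 and
`e⁴ + 3 e⁻⁴ - 4 r > 0` at 4. -/
lemma exists_cosh_sub_cos_eq {r : ℝ} (hr0 : 0 ≤ r) (hr1 : r ≤ 1) :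
    ∃ t : ℝ, 0 < t ∧ t * (Real.cosh t - r) = 2 * Real.sinh t := by
  have hc : Continuous fun t : ℝ => t * (Real.cosh t - r) - 2 * Real.sinh t := by
    have := Real.continuous_cosh
    have := Real.continuous_sinh
    fun_prop
  have h1 : (1 : ℝ) * (Real.cosh 1 - r) - 2 * Real.sinh 1 ≤ 0 := by
    have h2 := Real.add_one_le_exp (1 : ℝ)
    have h3 : Real.exp (-1) ≤ 1 / 2 := by
      rw [Real.exp_neg, one_div]
      exact inv_anti₀ (by norm_num) (by linarith)
    rw [Real.cosh_eq, Real.sinh_eq]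
    linarith
  have h4 : 0 ≤ (4 : ℝ) * (Real.cosh 4 - r) - 2 * Real.sinh 4 := by
    have h2 := Real.add_one_le_exp (4 : ℝ)
    have h3 := Real.exp_pos (-4)
    rw [Real.cosh_eq, Real.sinh_eq]
    linarith
  obtain ⟨t, ht, h⟩ := intermediate_value_Icc (by norm_num : (1 : ℝ) ≤ 4) hc.continuousOn ⟨h1, h4⟩
  exact ⟨t, by linarith [ht.1], sub_eq_zero.1 h⟩

lemma exists_negative_eigenvalue {n : ℕ} (hn : 2 ≤ n) : ∃ l : ℝ, l < 0 ∧ IsEigenvalue n l := by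
  have hn0 : (0 : ℝ) < n := by exact_mod_cast (by omega : 0 < n)
  have hn2 : (2 : ℝ) ≤ n := by exact_mod_cast hn
  set θ : ℝ := Real.pi / n with hθ
  have hθ0 : 0 < θ := div_pos Real.pi_pos hn0
  have hθ2 : θ ≤ Real.pi / 2 := div_le_div_of_nonneg_left Real.pi_pos.le (by norm_num) hn2
  obtain ⟨t, ht, hteq⟩ := exists_cosh_sub_cos_eq
    (Real.cos_nonneg_of_neg_pi_div_two_le_of_le (by linarith) hθ2) (Real.cos_le_one θ)
  set s : ℝ := n * t with hs
  have hs0 : 0 < s := mul_pos hn0 ht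
  have hst : s * (1 / n) = t := by rw [hs]; field_simp
  choose! h hA hE using exists_hat_nodes (p := fun x => Real.sinh (s * x))
    (q := fun x => s * Real.cosh (s * x)) (κ := s ^ 2)
    (fun x => by simpa [mul_comm] using ((hasDerivAt_id x).const_mul s).sinh)
    (fun x => by
      have := (((hasDerivAt_id x).const_mul s).cosh).const_mul s
      refine this.congr_deriv ?_
      simp only [id]
      ring) (by simp) n
  -- The first Dirichlet eigenvector of the discrete Laplacian on the nodes.
  set x : ℕ → ℝ := fun k => Real.sin (k * θ) with hx
  have hx0 : x 0 = 0 := by simp [hx]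
  have hxn : x n = 0 := by simp [hx, hθ, mul_div_cancel₀ _ hn0.ne']
  have hrec : ∀ k, x k + x (k + 2) = 2 * Real.cos θ * x (k + 1) := by
    intro k
    simp only [hx]
    push_cast
    rw [show (k : ℝ) * θ = (k + 1) * θ - θ by ring, show ((k : ℝ) + 2) * θ = (k + 1) * θ + θ by ring,
      Real.sin_sub, Real.sin_add]
    ring
  set m := n - 1 with hm
  have hnm : n = m + 1 := by omega
  -- The index is shifted: `h k` is centred at the node `(k + 1)/n`.
  let u : H01 := ∑ k ∈ Finset.range m, x (k + 1) • h k
  have hu : ∀ j ∈ Finset.range m, eval u ((j + 1 : ℕ) / n) = x (j + 1) * Real.sinh t := by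
    intro j hj
    rw [← dirac_apply, map_sum]
    rw [Finset.sum_eq_single_of_mem j hj]
    · rw [map_smul, dirac_apply, hE j (by have := Finset.mem_range.1 hj; omega), if_pos rfl, hst]
      rfl
    · intro k hk hkj
      rw [map_smul, dirac_apply, hE k (by have := Finset.mem_range.1 hk; omega),
        if_neg (by omega), smul_zero]
  refine ⟨-s ^ 2, by nlinarith, u, fun hu0 => ?_, ?_⟩
  · have h1 := hu 0 (Finset.mem_range.2 (by omega))
    rw [hu0, ← dirac_apply, map_zero] at h1
    have h2 : 0 < x (0 + 1) := by
      simp only [hx, zero_add, Nat.cast_one, one_mul]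
      exact Real.sin_pos_of_pos_of_lt_pi hθ0 (by linarith [Real.pi_pos])
    exact (mul_pos h2 (Real.sinh_pos_iff.2 ht)).ne h1
  · ext φ
    set y : ℕ → ℝ := fun k => eval φ ((k : ℝ) / n) with hy
    have hy0 : y 0 = 0 := eval_zero_div φ n
    have hyn : y (m + 1) = 0 := hnm ▸ eval_self_div φ (by omega)
    have hxn' : x (m + 1) = 0 := hnm ▸ hxn
    have hB : opB n u φ =
        -(4 * n * ∑ k ∈ Finset.range m, x (k + 1) * Real.sinh t * y (k + 1)) := by
      rw [opB_apply, Finset.sum_Ico_eq_sum_range]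
      congr 2
      refine Finset.sum_congr rfl fun k hk => ?_
      rw [add_comm 1 k, hu k hk]
    have hAu : opA u φ + s ^ 2 * incl u φ = ∑ k ∈ Finset.range m,
        x (k + 1) * (2 * (s * Real.cosh t) * y (k + 1) - s * (y k + y (k + 2))) := by
      simp only [u, map_sum, map_smul, sum_apply,
        smul_apply, smul_eq_mul, Finset.mul_sum, ← Finset.sum_add_distrib]
      refine Finset.sum_congr rfl fun k hk => ?_
      have h1 := hA k (by have := Finset.mem_range.1 hk; omega) φ
      simp only [hst, mul_zero, Real.cosh_zero, mul_one] at h1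
      rw [← h1]
      ring
    -- Summation by parts; the boundary terms vanish because `x` and `y` are zero at both ends.
    have hshift : ∑ k ∈ Finset.range m, x (k + 1) * (y k + y (k + 2)) =
        ∑ k ∈ Finset.range m, (x k + x (k + 2)) * y (k + 1) := by
      have s1 := Finset.sum_range_succ' (fun k => x (k + 1) * y k) m
      rw [Finset.sum_range_succ] at s1
      have s2 := Finset.sum_range_succ' (fun k => x k * y (k + 1)) m
      rw [Finset.sum_range_succ] at s2
      simp only [hx0, hy0, hxn', hyn, mul_zero, zero_mul, add_zero] at s1 s2
      simp only [mul_add, add_mul, Finset.sum_add_distrib]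
      rw [s1, s2]
      ring
    have hsum : opA u φ + s ^ 2 * incl u φ =
        4 * n * ∑ k ∈ Finset.range m, x (k + 1) * Real.sinh t * y (k + 1) := by
      have e : opA u φ + s ^ 2 * incl u φ =
          2 * (s * Real.cosh t) * (∑ k ∈ Finset.range m, x (k + 1) * y (k + 1)) -
            s * ∑ k ∈ Finset.range m, x (k + 1) * (y k + y (k + 2)) := by
        rw [hAu, Finset.mul_sum, Finset.mul_sum, ← Finset.sum_sub_distrib]
        exact Finset.sum_congr rfl fun k _ => by ring
      rw [e, hshift, Finset.mul_sum, Finset.mul_sum, Finset.mul_sum, ← Finset.sum_sub_distrib]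
      refine Finset.sum_congr rfl fun k _ => ?_
      rw [hrec k, hs]
      -- Each node contributes `2 n t (cosh t - cos θ) = 4 n sinh t`, the equation defining `t`.
      linear_combination 2 * n * x (k + 1) * y (k + 1) * hteq
    have hgoal : opL n u φ = -s ^ 2 * incl u φ := by
      rw [opL_apply, hB]
      linarith
    exact hgoal

end DiracLinearization

end

theorem mainTheorem3 (n : ℕ) (hn : 2 ≤ n) :
    (∃ l : ℝ, l < 0 ∧ DiracLinearization.IsEigenvalue n l) ∧
    ({l : ℝ | l < 0 ∧ DiracLinearization.IsEigenvalue n l}.Finite ∧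
      ∀ l : ℝ, l < 0 → FiniteDimensional ℝ (DiracLinearization.eigenspace n l)) ∧
    ¬ DiracLinearization.IsEigenvalue n 0 :=
  ⟨DiracLinearization.exists_negative_eigenvalue hn,
    ⟨DiracLinearization.finite_negative_eigenvalues n,
      fun _ hl => DiracLinearization.finiteDimensional_eigenspace n hl⟩,
    DiracLinearization.not_isEigenvalue_zero hn⟩
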